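/- Let $K_1,K_2$ be complex Hilbert spaces, let $U_1,U_2$ be unitary operators on $K_1,K_2$, and let $W$ be a unitary operator on the Hilbert space direct sum $H=K_1\oplus K_2$ such that $W-U_1\oplus U_2$ has rank one (in particular is nonzero). Let $\varphi=(\varphi_1,\varphi_2)\in H$ span the one-dimensional space $\ker(W-U_1\oplus U_2)^{\perp}$, and suppose that $\varphi_j$ is cyclic for $U_j$, i.e. the closed linear span of $\{U_j^n\varphi_j : n\in\mathbb Z\}$ is $K_j$, for $j=1,2$. Then the singular spectrum of $W$ is simple, that is: for $x\in H$ let $\mu_x$ be the spectral measure of $W$ and $x$, the finite positive measure on the unit circle with $\int z^n\,d\mu_x(z)=\langle x,W^n x\rangle$ for all $n\in\mathbb Z$, and let $H_s$ be the set of all $x\in H$ such that $\mu_x$ is singular with respect to Lebesgue measure on the circle; then there is a vector $\psi\in H_s$ such that the closed linear span of $\{W^n\psi : n\in\mathbb Z\}$ equals $H_s$. -/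

import Mathlib

open MeasureTheory
open scoped InnerProductSpace

noncomputable section

instance fact_zero_lt_two_mul_pi : Fact (0 < 2 * Real.pi) := ⟨Real.two_pi_pos⟩

/-- The closed cyclic subspace generated by `x` and the unitary operator `U`, i.e. the closed
linear span of `U ^ n x`, `n ∈ ℤ`. -/
def unitaryCyclicSubspace {H : Type*} [NormedAddCommGroup H] [InnerProductSpace ℂ H]
    (U : H ≃ₗᵢ[ℂ] H) (x : H) : Submodule ℂ H :=
  (Submodule.span ℂ (Set.range fun n : ℤ => (U ^ n) x)).topologicalClosure

/-- `x` is a cyclic vector for the unitary operator `U`. -/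
def IsCyclicVector {H : Type*} [NormedAddCommGroup H] [InnerProductSpace ℂ H]
    (U : H ≃ₗᵢ[ℂ] H) (x : H) : Prop :=
  unitaryCyclicSubspace U x = ⊤

/-- `μ` is the spectral measure of the unitary operator `U` and the vector `x`: the finite
positive measure on the unit circle with `∫ z ^ n dμ(z) = ⟪x, U ^ n x⟫` for all integers `n`
(existence is the spectral theorem, and a finite measure on the circle is determined by these
moments). The unit circle is parametrized by `t ↦ z = exp (i t)`, `t ∈ ℝ / 2πℤ`, and
`fourier n t = exp (i n t)`. -/
def IsUnitarySpectralMeasure {H : Type*} [NormedAddCommGroup H] [InnerProductSpace ℂ H]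
    (U : H ≃ₗᵢ[ℂ] H) (x : H) (μ : Measure (AddCircle (2 * Real.pi))) : Prop :=
  IsFiniteMeasure μ ∧ ∀ n : ℤ, ∫ t, fourier n t ∂μ = ⟪x, (U ^ n) x⟫_ℂ

/-- The singular subspace of the unitary operator `U`: all vectors whose spectral measure is
singular with respect to Lebesgue measure on the circle. It covers both the pure point and the
singular continuous part. -/
def unitarySingularSubspace {H : Type*} [NormedAddCommGroup H] [InnerProductSpace ℂ H]
    (U : H ≃ₗᵢ[ℂ] H) : Set H :=
  {x | ∃ μ : Measure (AddCircle (2 * Real.pi)), IsUnitarySpectralMeasure U x μ ∧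
    μ ⟂ₘ (volume : Measure (AddCircle (2 * Real.pi)))}

/-- The singular spectrum of `U` is simple: the restriction of `U` to its singular subspace has
a cyclic vector. (The equality also forces `ψ` itself to lie in the singular subspace.) -/
def HasSimpleSingularSpectrum {H : Type*} [NormedAddCommGroup H] [InnerProductSpace ℂ H]
    (U : H ≃ₗᵢ[ℂ] H) : Prop :=
  ∃ ψ : H, (unitaryCyclicSubspace U ψ : Set H) = unitarySingularSubspace U

/-- The orthogonal direct sum `U₁ ⊕ U₂` on the Hilbert space direct sum `K₁ ⊕ K₂`. -/
def unitaryDirectSum {K₁ K₂ : Type*} [NormedAddCommGroup K₁] [InnerProductSpace ℂ K₁]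
    [NormedAddCommGroup K₂] [InnerProductSpace ℂ K₂]
    (U₁ : K₁ ≃ₗᵢ[ℂ] K₁) (U₂ : K₂ ≃ₗᵢ[ℂ] K₂) :
    WithLp 2 (K₁ × K₂) ≃ₗᵢ[ℂ] WithLp 2 (K₁ × K₂) :=
  LinearIsometryEquiv.withLpProdCongr 2 U₁ U₂

/-- The difference `W - V` of two unitary operators, as a linear operator. -/
def unitaryDifference {H : Type*} [NormedAddCommGroup H] [InnerProductSpace ℂ H]
    (W V : H ≃ₗᵢ[ℂ] H) : H →ₗ[ℂ] H :=
  W.toLinearEquiv.toLinearMap - V.toLinearEquiv.toLinearMap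

end

/-! Write V for U₁ ⊕ U₂. Since W and V agree on φᗮ, W x = V x + c⟪φ, x⟫ Wφ with c ≠ 0. Let P project
onto the singular subspace of W, M be the V-cyclic subspace of φ, and Q project onto Mᗮ, where W and
V coincide.

The heart is an Aronszajn–Donoghue statement (`mutuallySingular_of_rankOne`): the W-spectral measure
of Pφ is singular to the V-spectral measure of φ. A nonzero common minorant τ would have moments ⟪φ,
Vᵏ a⟫ = ⟪φ, Wᵏ b⟫. By the rank one formula, ⟪Wʲ b, Vʲ a⟫ drops by c|τ̂(j)|² at each step, so the
moments are square summable and τ has an L² density. But τ lies below a singular measure, so τ = 0.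

Cyclicity of φ₁ and φ₂ makes φ of maximal spectral type for V, and φ together with e = (φ₁, 0)
generates H. Hence the W-spectral measure of P(Qe) is absolutely continuous with respect to the
V-spectral measure of φ, and so singular to that of Pφ. The sum ψ = Pφ + P(Qe) therefore generates
both summands (`mem_unitaryCyclicSubspace_add_of_mutuallySingular`). The first generates P M, the
second P Mᗮ, and together these give the whole singular subspace. -/

/-! ### Finite measures on the circle and their moments -/

section Circle

/-- Integration against a finite measure, as a continuous functional on the continuous functions
on the circle. -/
noncomputable def circleIntegralCLM (μ : Measure (AddCircle (2 * Real.pi))) [IsFiniteMeasure μ] :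
    C(AddCircle (2 * Real.pi), ℂ) →L[ℂ] ℂ :=
  LinearMap.mkContinuous
    { toFun := fun f => ∫ t, f t ∂μ
      map_add' := fun f g => integral_add (f.continuous.integrable_of_hasCompactSupport
        (HasCompactSupport.of_compactSpace _)) (g.continuous.integrable_of_hasCompactSupport
        (HasCompactSupport.of_compactSpace _))
      map_smul' := fun c f => integral_const_mul c _ } (μ.real Set.univ) (fun f => by
        have := norm_integral_le_of_norm_le_const (μ := μ) (f := f) (C := ‖f‖)
          (Filter.Eventually.of_forall fun t => f.norm_coe_le_norm t)
        simpa [mul_comm] using this)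

theorem circleIntegralCLM_apply (μ : Measure (AddCircle (2 * Real.pi))) [IsFiniteMeasure μ]
    (f : C(AddCircle (2 * Real.pi), ℂ)) : circleIntegralCLM μ f = ∫ t, f t ∂μ := rfl

/-- Continuous linear maps on `C(𝕋)` are determined by their values on the monomials. -/
theorem clm_ext_fourier {E : Type*} [NormedAddCommGroup E] [NormedSpace ℂ E]
    {F G : C(AddCircle (2 * Real.pi), ℂ) →L[ℂ] E} (h : ∀ n : ℤ, F (fourier n) = G (fourier n)) :
    F = G := by
  refine ContinuousLinearMap.ext_on (s := Set.range fourier) ?_ ?_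
  · rw [dense_iff_closure_eq, ← Submodule.topologicalClosure_coe, span_fourier_closure_eq_top]
    rfl
  · rintro _ ⟨n, rfl⟩
    exact h n

/-- A finite measure on the circle is determined by its trigonometric moments. -/
theorem measure_ext_fourier {μ ν : Measure (AddCircle (2 * Real.pi))} [IsFiniteMeasure μ]
    [IsFiniteMeasure ν] (h : ∀ n : ℤ, ∫ t, fourier n t ∂μ = ∫ t, fourier n t ∂ν) : μ = ν := by
  have key : circleIntegralCLM μ = circleIntegralCLM ν := clm_ext_fourier h
  refine ext_of_forall_integral_eq_of_IsFiniteMeasure fun f => ?_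
  have := congrArg (fun F => F ⟨fun t => (f t : ℂ), by fun_prop⟩) key
  simp only [circleIntegralCLM_apply, ContinuousMap.coe_mk] at this
  rw [integral_complex_ofReal, integral_complex_ofReal] at this
  exact_mod_cast this

theorem conj_integral_fourier (μ : Measure (AddCircle (2 * Real.pi))) (n : ℤ) :
    (starRingEnd ℂ) (∫ t, fourier n t ∂μ) = ∫ t, fourier (-n) t ∂μ := by
  rw [← integral_conj]
  simp only [fourier_neg]

end Circle

/-! ### Continuous functional calculus and existence of spectral measures -/

section Calculus

variable {H : Type*} [NormedAddCommGroup H] [InnerProductSpace ℂ H]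

theorem unitary_zpow_add_apply (U : H ≃ₗᵢ[ℂ] H) (m n : ℤ) (x : H) :
    (U ^ (m + n)) x = (U ^ m) ((U ^ n) x) := by rw [zpow_add]; rfl

theorem unitary_zpow_succ_apply (U : H ≃ₗᵢ[ℂ] H) (n : ℤ) (x : H) :
    (U ^ (n + 1)) x = U ((U ^ n) x) := by
  rw [add_comm, unitary_zpow_add_apply, zpow_one]

theorem unitary_inner_zpow (U : H ≃ₗᵢ[ℂ] H) (n : ℤ) (x y : H) :
    ⟪x, (U ^ n) y⟫_ℂ = ⟪(U ^ (-n)) x, y⟫_ℂ := by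
  rw [← LinearIsometryEquiv.inner_map_map (U ^ (-n)), ← unitary_zpow_add_apply]
  simp

variable [CompleteSpace H]

/-- The map from the spectrum of a unitary operator to `ℝ / 2πℤ`. -/
noncomputable def unitarySpectrumArg (u : unitary (H →L[ℂ] H)) :
    C(spectrum ℂ (u : H →L[ℂ] H), AddCircle (2 * Real.pi)) where
  toFun z := AddCircle.homeomorphCircle'.symm
    ⟨z, mem_sphere_zero_iff_norm.2 (by simpa using spectrum.subset_circle_of_unitary u.2 z.2)⟩
  continuous_toFun := by
    refine AddCircle.homeomorphCircle'.symm.continuous.comp ?_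
    exact Continuous.subtype_mk continuous_subtype_val _

theorem fourier_one_unitarySpectrumArg (u : unitary (H →L[ℂ] H))
    (z : spectrum ℂ (u : H →L[ℂ] H)) : fourier 1 (unitarySpectrumArg u z) = (z : ℂ) := by
  have : ∀ w : Circle, fourier 1 (AddCircle.homeomorphCircle'.symm w) = (w : ℂ) := by
    intro w
    obtain ⟨t, rfl⟩ := AddCircle.homeomorphCircle'.surjective w
    rw [Homeomorph.symm_apply_apply]
    induction t using QuotientAddGroup.induction_on with
    | H t =>
      rw [fourier_coe_apply, AddCircle.homeomorphCircle'_apply_mk, Circle.coe_exp]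
      congr 1
      push_cast
      field_simp
  exact this _

instance isStarNormal_coe_unitary (u : unitary (H →L[ℂ] H)) : IsStarNormal (u : H →L[ℂ] H) :=
  ⟨by simp [Commute, SemiconjBy]⟩

/-- The continuous functional calculus of a unitary operator, on functions on the circle. -/
noncomputable def unitaryCalculus (U : H ≃ₗᵢ[ℂ] H) :
    C(AddCircle (2 * Real.pi), ℂ) →⋆ₐ[ℂ] (H →L[ℂ] H) :=
  (cfcHom (R := ℂ) (isStarNormal_coe_unitary (Unitary.linearIsometryEquiv.symm U))).comp
    (ContinuousMap.compStarAlgHom' ℂ ℂ (unitarySpectrumArg (Unitary.linearIsometryEquiv.symm U)))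

theorem unitaryCalculus_continuous (U : H ≃ₗᵢ[ℂ] H) : Continuous (unitaryCalculus U) :=
  (cfcHom_continuous (R := ℂ) _).comp (ContinuousMap.continuous_precomp _)

theorem unitaryCalculus_fourier_one (U : H ≃ₗᵢ[ℂ] H) (x : H) :
    unitaryCalculus U (fourier 1) x = U x := by
  have : (ContinuousMap.compStarAlgHom' ℂ ℂ
      (unitarySpectrumArg (Unitary.linearIsometryEquiv.symm U))) (fourier 1) =
      (ContinuousMap.id ℂ).restrict (spectrum ℂ
        ((Unitary.linearIsometryEquiv.symm U : unitary (H →L[ℂ] H)) : H →L[ℂ] H)) := by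
    ext z
    exact fourier_one_unitarySpectrumArg _ z
  rw [unitaryCalculus, StarAlgHom.comp_apply, this, cfcHom_id]
  rfl

theorem fourier_mul (m n : ℤ) : (fourier (m + n) : C(AddCircle (2 * Real.pi), ℂ)) =
    fourier m * fourier n := by
  ext t
  exact fourier_add

theorem unitaryCalculus_fourier (U : H ≃ₗᵢ[ℂ] H) (n : ℤ) (x : H) :
    unitaryCalculus U (fourier n) x = (U ^ n) x := by
  have succ : ∀ n : ℤ, unitaryCalculus U (fourier (n + 1)) x =
      U (unitaryCalculus U (fourier n) x) := by
    intro n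
    rw [add_comm, fourier_mul, map_mul, mul_apply_eq_comp, unitaryCalculus_fourier_one]
  induction n with
  | zero =>
    have : (fourier 0 : C(AddCircle (2 * Real.pi), ℂ)) = 1 := by ext t; exact fourier_zero
    rw [this, map_one]
    simp
  | succ n ih => rw [succ, ih, unitary_zpow_succ_apply]
  | pred n ih =>
    apply U.injective
    rw [← succ, ← unitary_zpow_succ_apply]
    simpa using ih

/-- Source of both the positivity needed for Riesz–Markov and the L² isometry of the calculus. -/
theorem unitaryCalculus_inner_self (U : H ≃ₗᵢ[ℂ] H) (f : C(AddCircle (2 * Real.pi), ℂ)) (x : H) :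
    ⟪x, unitaryCalculus U (star f * f) x⟫_ℂ = (‖unitaryCalculus U f x‖ ^ 2 : ℝ) := by
  rw [map_mul, map_star, mul_apply_eq_comp, ContinuousLinearMap.star_eq_adjoint,
    ContinuousLinearMap.adjoint_inner_right, inner_self_eq_norm_sq_to_K]
  simp

theorem IsUnitarySpectralMeasure.integral_eq {U : H ≃ₗᵢ[ℂ] H} {x : H}
    {μ : Measure (AddCircle (2 * Real.pi))} (h : IsUnitarySpectralMeasure U x μ)
    (f : C(AddCircle (2 * Real.pi), ℂ)) : ∫ t, f t ∂μ = ⟪x, unitaryCalculus U f x⟫_ℂ := by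
  obtain ⟨hμ, h⟩ := h
  let G : C(AddCircle (2 * Real.pi), ℂ) →L[ℂ] ℂ := innerSL ℂ x ∘L
    (ContinuousLinearMap.apply ℂ H x) ∘L
    ⟨(unitaryCalculus U).toAlgHom.toLinearMap, unitaryCalculus_continuous U⟩
  have : circleIntegralCLM μ = G := by
    refine clm_ext_fourier fun n => ?_
    rw [circleIntegralCLM_apply, h]
    change _ = ⟪x, unitaryCalculus U (fourier n) x⟫_ℂ
    rw [unitaryCalculus_fourier]
  exact congrArg (fun F => F f) this

theorem IsUnitarySpectralMeasure.integral_norm_sq {U : H ≃ₗᵢ[ℂ] H} {x : H}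
    {μ : Measure (AddCircle (2 * Real.pi))} (h : IsUnitarySpectralMeasure U x μ)
    (f : C(AddCircle (2 * Real.pi), ℂ)) :
    ∫ t, ‖f t‖ ^ 2 ∂μ = ‖unitaryCalculus U f x‖ ^ 2 := by
  have := h.integral_eq (star f * f)
  rw [unitaryCalculus_inner_self] at this
  have e : ∀ t, (star f * f) t = ((‖f t‖ ^ 2 : ℝ) : ℂ) := by
    intro t
    simp [Complex.conj_mul']
  simp only [e] at this
  rw [integral_complex_ofReal] at this
  exact_mod_cast this

theorem unitaryCalculus_mem_unitaryCyclicSubspace (U : H ≃ₗᵢ[ℂ] H)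
    (f : C(AddCircle (2 * Real.pi), ℂ)) (x : H) :
    unitaryCalculus U f x ∈ unitaryCyclicSubspace U x := by
  have hf : f ∈ (Submodule.span ℂ (Set.range (@fourier (2 * Real.pi)))).topologicalClosure := by
    rw [span_fourier_closure_eq_top]
    trivial
  let G : C(AddCircle (2 * Real.pi), ℂ) →L[ℂ] H := (ContinuousLinearMap.apply ℂ H x) ∘L
    ⟨(unitaryCalculus U).toAlgHom.toLinearMap, unitaryCalculus_continuous U⟩
  refine closure_minimal (t := G ⁻¹' (unitaryCyclicSubspace U x : Set H)) ?_
    ((Submodule.isClosed_topologicalClosure _).preimage G.continuous) hf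
  intro g hg
  change g ∈ (unitaryCyclicSubspace U x).comap G.toLinearMap
  refine Submodule.span_le.2 ?_ hg
  rintro _ ⟨n, rfl⟩
  refine Submodule.le_topologicalClosure _ (Submodule.subset_span ⟨n, ?_⟩)
  exact (unitaryCalculus_fourier U n x).symm

/-- Existence of the spectral measure of a unitary operator and a vector. -/
theorem exists_isUnitarySpectralMeasure (U : H ≃ₗᵢ[ℂ] H) (x : H) :
    ∃ μ : Measure (AddCircle (2 * Real.pi)), IsUnitarySpectralMeasure U x μ := by
  let c : CompactlySupportedContinuousMap (AddCircle (2 * Real.pi)) ℝ →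
      C(AddCircle (2 * Real.pi), ℂ) := fun f => ⟨fun t => (f t : ℂ), by fun_prop⟩
  let Λ₀ : CompactlySupportedContinuousMap (AddCircle (2 * Real.pi)) ℝ →ₗ[ℝ] ℝ :=
    { toFun := fun f => (⟪x, unitaryCalculus U (c f) x⟫_ℂ).re
      map_add' := fun f g => by
        have : c (f + g) = c f + c g := by ext t; simp [c]
        rw [this, map_add, add_apply, inner_add_right, Complex.add_re]
      map_smul' := fun r f => by
        have : c (r • f) = (r : ℂ) • c f := by ext t; simp [c]
        rw [this, map_smul, smul_apply, inner_smul_right, Complex.re_ofReal_mul]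
        rfl }
  -- Positivity of the functional: a nonnegative f is `star g * g` with g = √f.
  have root : ∀ f, 0 ≤ f → ∃ g : C(AddCircle (2 * Real.pi), ℂ), c f = star g * g := by
    intro f hf
    refine ⟨⟨fun t => (Real.sqrt (f t) : ℂ), by fun_prop⟩, ?_⟩
    ext t
    have : Real.sqrt (f t) * Real.sqrt (f t) = f t := Real.mul_self_sqrt (hf t)
    simp [c, ← Complex.ofReal_mul, this]
  let Λ : CompactlySupportedContinuousMap (AddCircle (2 * Real.pi)) ℝ →ₚ[ℝ] ℝ :=
    PositiveLinearMap.mk₀ Λ₀ fun f hf => by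
      obtain ⟨g, hg⟩ := root f hf
      change 0 ≤ (⟪x, unitaryCalculus U (c f) x⟫_ℂ).re
      rw [hg, unitaryCalculus_inner_self, Complex.ofReal_re]
      positivity
  have hΛ : ∀ f, ((∫ t, f t ∂(RealRMK.rieszMeasure Λ) : ℝ) : ℂ) =
      ⟪x, unitaryCalculus U (c f) x⟫_ℂ := by
    intro f
    rw [RealRMK.integral_rieszMeasure]
    change (((⟪x, unitaryCalculus U (c f) x⟫_ℂ).re : ℝ) : ℂ) = _
    -- For real f the operator f(U) is self-adjoint, so taking the real part in `Λ₀` lost nothing.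
    have hs : star (c f) = c f := by ext t; simp [c]
    refine Complex.conj_eq_iff_re.1 ?_
    rw [inner_conj_symm]
    nth_rw 1 [← hs]
    rw [map_star, ContinuousLinearMap.star_eq_adjoint, ContinuousLinearMap.adjoint_inner_left]
  refine ⟨RealRMK.rieszMeasure Λ, inferInstance, fun n => ?_⟩
  let re : CompactlySupportedContinuousMap (AddCircle (2 * Real.pi)) ℝ :=
    ⟨⟨fun t => (fourier n t).re, by fun_prop⟩, HasCompactSupport.of_compactSpace _⟩
  let im : CompactlySupportedContinuousMap (AddCircle (2 * Real.pi)) ℝ :=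
    ⟨⟨fun t => (fourier n t).im, by fun_prop⟩, HasCompactSupport.of_compactSpace _⟩
  have hn : (fourier n : C(AddCircle (2 * Real.pi), ℂ)) = c re + Complex.I • c im := by
    ext t
    change fourier n t = ((fourier n t).re : ℂ) + Complex.I * ((fourier n t).im : ℂ)
    rw [mul_comm Complex.I, Complex.re_add_im]
  have hint : Integrable (fun t => fourier n t) (RealRMK.rieszMeasure Λ) :=
    (fourier n).continuous.integrable_of_hasCompactSupport (HasCompactSupport.of_compactSpace _)
  rw [← unitaryCalculus_fourier, hn, map_add, map_smul, add_apply,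
    smul_apply, inner_add_right, inner_smul_right, ← hΛ, ← hΛ, ← hn,
    ← integral_re_add_im hint, mul_comm Complex.I]
  rfl

end Calculus

/-! ### Reducing subspaces, spectral measures and the singular subspace -/

section SpectralMeasure

variable {H : Type*} [NormedAddCommGroup H] [InnerProductSpace ℂ H]

/-- A linear subspace is reducing for `U` if it is invariant under `U` and its inverse. -/
def IsReducing (U : H ≃ₗᵢ[ℂ] H) (K : Submodule ℂ H) : Prop :=
  ∀ x ∈ K, U x ∈ K ∧ U.symm x ∈ K

theorem isReducing_of_zpow {U : H ≃ₗᵢ[ℂ] H} {K : Submodule ℂ H}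
    (h : ∀ n : ℤ, ∀ x ∈ K, (U ^ n) x ∈ K) : IsReducing U K := by
  refine fun x hx => ⟨by simpa using h 1 x hx, ?_⟩
  have := h (-1) x hx
  rw [zpow_neg_one] at this
  exact this

theorem IsReducing.zpow_mem {U : H ≃ₗᵢ[ℂ] H} {K : Submodule ℂ H} (hK : IsReducing U K) {x : H}
    (hx : x ∈ K) (n : ℤ) : (U ^ n) x ∈ K := by
  induction n with
  | zero => simpa using hx
  | succ n ih =>
    rw [unitary_zpow_succ_apply]
    exact (hK _ ih).1
  | pred n ih =>
    have : (U ^ (-(n : ℤ) - 1)) x = U.symm ((U ^ (-(n : ℤ))) x) := by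
      apply U.injective
      rw [← unitary_zpow_succ_apply, U.apply_symm_apply, sub_add_cancel]
    rw [this]
    exact (hK _ ih).2

theorem IsReducing.unitaryCyclicSubspace_le {U : H ≃ₗᵢ[ℂ] H} {K : Submodule ℂ H}
    (hK : IsReducing U K) (hc : IsClosed (K : Set H)) {x : H} (hx : x ∈ K) :
    unitaryCyclicSubspace U x ≤ K := by
  refine Submodule.topologicalClosure_minimal _ (Submodule.span_le.2 ?_) hc
  rintro _ ⟨n, rfl⟩
  exact hK.zpow_mem hx n

theorem zpow_mem_unitaryCyclicSubspace (U : H ≃ₗᵢ[ℂ] H) (x : H) (n : ℤ) :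
    (U ^ n) x ∈ unitaryCyclicSubspace U x :=
  Submodule.le_topologicalClosure _ (Submodule.subset_span ⟨n, rfl⟩)

theorem self_mem_unitaryCyclicSubspace (U : H ≃ₗᵢ[ℂ] H) (x : H) :
    x ∈ unitaryCyclicSubspace U x := by
  simpa using zpow_mem_unitaryCyclicSubspace U x 0

theorem isClosed_unitaryCyclicSubspace (U : H ≃ₗᵢ[ℂ] H) (x : H) :
    IsClosed (unitaryCyclicSubspace U x : Set H) :=
  Submodule.isClosed_topologicalClosure _

theorem isReducing_unitaryCyclicSubspace (U : H ≃ₗᵢ[ℂ] H) (x : H) :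
    IsReducing U (unitaryCyclicSubspace U x) := by
  refine isReducing_of_zpow fun m => ?_
  have hle : unitaryCyclicSubspace U x ≤
      (unitaryCyclicSubspace U x).comap (U ^ m).toLinearEquiv.toLinearMap := by
    refine Submodule.topologicalClosure_minimal _ (Submodule.span_le.2 ?_)
      ((isClosed_unitaryCyclicSubspace U x).preimage (U ^ m).continuous)
    rintro _ ⟨n, rfl⟩
    change (U ^ m) ((U ^ n) x) ∈ unitaryCyclicSubspace U x
    rw [← unitary_zpow_add_apply]
    exact zpow_mem_unitaryCyclicSubspace U x _
  exact fun y hy => hle hy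

theorem IsReducing.orthogonal {U : H ≃ₗᵢ[ℂ] H} {K : Submodule ℂ H} (hK : IsReducing U K) :
    IsReducing U Kᗮ := by
  intro x hx
  refine ⟨fun y hy => ?_, fun y hy => ?_⟩
  · rw [← U.symm.inner_map_map, U.symm_apply_apply]
    exact hx _ (hK y hy).2
  · rw [← U.inner_map_map, U.apply_symm_apply]
    exact hx _ (hK y hy).1

/-- Powers of U preserve both summands of the splitting along K and Kᗮ. -/
theorem IsReducing.starProjection_zpow {U : H ≃ₗᵢ[ℂ] H} {K : Submodule ℂ H}
    [K.HasOrthogonalProjection] (hK : IsReducing U K) (n : ℤ) (x : H) :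
    K.starProjection ((U ^ n) x) = (U ^ n) (K.starProjection x) := by
  refine Submodule.eq_starProjection_of_mem_orthogonal
    (hK.zpow_mem (K.starProjection_apply_mem x) n) ?_
  rw [← map_sub]
  exact hK.orthogonal.zpow_mem (K.sub_starProjection_mem_orthogonal x) n

theorem IsUnitarySpectralMeasure.unique {U : H ≃ₗᵢ[ℂ] H} {x : H}
    {μ ν : Measure (AddCircle (2 * Real.pi))} (hμ : IsUnitarySpectralMeasure U x μ)
    (hν : IsUnitarySpectralMeasure U x ν) : μ = ν := by
  have := hμ.1
  have := hν.1
  exact measure_ext_fourier fun n => by rw [hμ.2, hν.2]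

variable [CompleteSpace H]

/-- The spectral measure of a unitary operator and a vector. -/
noncomputable def unitarySpectralMeasure (U : H ≃ₗᵢ[ℂ] H) (x : H) :
    Measure (AddCircle (2 * Real.pi)) :=
  (exists_isUnitarySpectralMeasure U x).choose

theorem isUnitarySpectralMeasure_unitarySpectralMeasure (U : H ≃ₗᵢ[ℂ] H) (x : H) :
    IsUnitarySpectralMeasure U x (unitarySpectralMeasure U x) :=
  (exists_isUnitarySpectralMeasure U x).choose_spec

instance isFiniteMeasure_unitarySpectralMeasure (U : H ≃ₗᵢ[ℂ] H) (x : H) :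
    IsFiniteMeasure (unitarySpectralMeasure U x) :=
  (isUnitarySpectralMeasure_unitarySpectralMeasure U x).1

theorem integral_fourier_unitarySpectralMeasure (U : H ≃ₗᵢ[ℂ] H) (x : H) (n : ℤ) :
    ∫ t, fourier n t ∂(unitarySpectralMeasure U x) = ⟪x, (U ^ n) x⟫_ℂ :=
  (isUnitarySpectralMeasure_unitarySpectralMeasure U x).2 n

theorem mem_unitarySingularSubspace_iff {U : H ≃ₗᵢ[ℂ] H} {x : H} :
    x ∈ unitarySingularSubspace U ↔
      unitarySpectralMeasure U x ⟂ₘ (volume : Measure (AddCircle (2 * Real.pi))) := by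
  refine ⟨?_, fun h => ⟨_, isUnitarySpectralMeasure_unitarySpectralMeasure U x, h⟩⟩
  rintro ⟨μ, hμ, h⟩
  rwa [(isUnitarySpectralMeasure_unitarySpectralMeasure U x).unique hμ]

theorem integral_fourier_add_measure (μ ν : Measure (AddCircle (2 * Real.pi)))
    [IsFiniteMeasure μ] [IsFiniteMeasure ν] (n : ℤ) :
    ∫ t, fourier n t ∂(μ + ν) = ∫ t, fourier n t ∂μ + ∫ t, fourier n t ∂ν :=
  integral_add_measure
    ((fourier n).continuous.integrable_of_hasCompactSupport (HasCompactSupport.of_compactSpace _))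
    ((fourier n).continuous.integrable_of_hasCompactSupport (HasCompactSupport.of_compactSpace _))

theorem unitarySpectralMeasure_map (U : H ≃ₗᵢ[ℂ] H) (n : ℤ) (x : H) :
    unitarySpectralMeasure U ((U ^ n) x) = unitarySpectralMeasure U x := by
  refine measure_ext_fourier fun m => ?_
  rw [integral_fourier_unitarySpectralMeasure, integral_fourier_unitarySpectralMeasure,
    ← unitary_zpow_add_apply, add_comm, unitary_zpow_add_apply, LinearIsometryEquiv.inner_map_map]

theorem unitarySpectralMeasure_congr {U V : H ≃ₗᵢ[ℂ] H} {x : H}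
    (h : ∀ n : ℤ, (U ^ n) x = (V ^ n) x) :
    unitarySpectralMeasure U x = unitarySpectralMeasure V x := by
  refine measure_ext_fourier fun m => ?_
  rw [integral_fourier_unitarySpectralMeasure, integral_fourier_unitarySpectralMeasure, h]

theorem unitarySpectralMeasure_univ (U : H ≃ₗᵢ[ℂ] H) (x : H) :
    unitarySpectralMeasure U x Set.univ = ENNReal.ofReal (‖x‖ ^ 2) := by
  have := integral_fourier_unitarySpectralMeasure U x 0
  simp only [fourier_zero, integral_const, zpow_zero, LinearIsometryEquiv.coe_one, id_eq,
    inner_self_eq_norm_sq_to_K] at this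
  have h2 : (unitarySpectralMeasure U x).real Set.univ = ‖x‖ ^ 2 := by
    simpa [← Complex.ofReal_pow] using this
  rw [← h2, measureReal_def, ENNReal.ofReal_toReal (measure_ne_top _ _)]

theorem unitarySpectralMeasure_zero (U : H ≃ₗᵢ[ℂ] H) : unitarySpectralMeasure U 0 = 0 := by
  rw [← Measure.measure_univ_eq_zero, unitarySpectralMeasure_univ]
  simp

theorem unitarySpectralMeasure_smul (U : H ≃ₗᵢ[ℂ] H) (c : ℂ) (x : H) :
    unitarySpectralMeasure U (c • x) = (‖c‖₊ ^ 2) • unitarySpectralMeasure U x := by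
  refine measure_ext_fourier fun n => ?_
  rw [integral_smul_nnreal_measure, integral_fourier_unitarySpectralMeasure,
    integral_fourier_unitarySpectralMeasure, map_smul, inner_smul_left, inner_smul_right,
    ← mul_assoc, Complex.conj_mul', NNReal.smul_def]
  simp

theorem unitarySpectralMeasure_parallelogram (U : H ≃ₗᵢ[ℂ] H) (x y : H) :
    unitarySpectralMeasure U (x + y) + unitarySpectralMeasure U (x - y) =
      (unitarySpectralMeasure U x + unitarySpectralMeasure U x) +
        (unitarySpectralMeasure U y + unitarySpectralMeasure U y) := by
  refine measure_ext_fourier fun n => ?_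
  simp only [integral_fourier_add_measure, integral_fourier_unitarySpectralMeasure, map_add,
    map_sub, inner_add_left, inner_add_right, inner_sub_left, inner_sub_right]
  ring

/-- The parallelogram law with the measure of x - y dropped. This crude bound suffices for null sets
and singularity to pass to sums. -/
theorem unitarySpectralMeasure_add_le (U : H ≃ₗᵢ[ℂ] H) (x y : H) :
    unitarySpectralMeasure U (x + y) ≤
      (unitarySpectralMeasure U x + unitarySpectralMeasure U x) +
        (unitarySpectralMeasure U y + unitarySpectralMeasure U y) := by
  rw [← unitarySpectralMeasure_parallelogram]
  exact Measure.le_add_right le_rfl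

theorem unitarySpectralMeasure_add_of_orthogonal {U : H ≃ₗᵢ[ℂ] H} {x y : H}
    (h : ∀ n : ℤ, ⟪x, (U ^ n) y⟫_ℂ = 0) :
    unitarySpectralMeasure U (x + y) = unitarySpectralMeasure U x + unitarySpectralMeasure U y := by
  have h' : ∀ n : ℤ, ⟪y, (U ^ n) x⟫_ℂ = 0 := by
    intro n
    rw [unitary_inner_zpow, ← inner_conj_symm, h, map_zero]
  refine measure_ext_fourier fun n => ?_
  simp only [integral_fourier_add_measure, integral_fourier_unitarySpectralMeasure, map_add,
    inner_add_left, inner_add_right, h, h']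
  ring

/-- The components of x in K and Kᗮ have orthogonal orbits, so their spectral measures add up to
that of x. -/
theorem IsReducing.unitarySpectralMeasure_starProjection_le {U : H ≃ₗᵢ[ℂ] H} {K : Submodule ℂ H}
    [K.HasOrthogonalProjection] (hK : IsReducing U K) (x : H) :
    unitarySpectralMeasure U (K.starProjection x) ≤ unitarySpectralMeasure U x := by
  have := unitarySpectralMeasure_add_of_orthogonal (U := U) (x := K.starProjection x)
    (y := x - K.starProjection x) fun n =>
      hK.orthogonal.zpow_mem (K.sub_starProjection_mem_orthogonal x) n _
        (K.starProjection_apply_mem x)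
  rw [add_sub_cancel] at this
  rw [this]
  exact Measure.le_add_right le_rfl

/-- The vectors whose spectral measure vanishes on a given family of sets. -/
noncomputable def spectralNullSubspace (U : H ≃ₗᵢ[ℂ] H)
    (𝒜 : Set (Set (AddCircle (2 * Real.pi)))) : Submodule ℂ H where
  carrier := {x | ∀ A ∈ 𝒜, unitarySpectralMeasure U x A = 0}
  zero_mem' := fun A _ => by rw [unitarySpectralMeasure_zero]; rfl
  add_mem' := fun {x y} hx hy A hA => by
    refine le_antisymm ((unitarySpectralMeasure_add_le U x y A).trans ?_) zero_le
    simp [hx A hA, hy A hA]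
  smul_mem' := fun c x hx A hA => by
    rw [unitarySpectralMeasure_smul]
    simp [hx A hA]

theorem isReducing_spectralNullSubspace (U : H ≃ₗᵢ[ℂ] H)
    (𝒜 : Set (Set (AddCircle (2 * Real.pi)))) : IsReducing U (spectralNullSubspace U 𝒜) := by
  refine isReducing_of_zpow fun n x hx A hA => ?_
  rw [unitarySpectralMeasure_map]
  exact hx A hA

/-- If u gives A measure zero, then x gives it at most 2‖x - u‖². -/
theorem isClosed_spectralNullSubspace (U : H ≃ₗᵢ[ℂ] H)
    (𝒜 : Set (Set (AddCircle (2 * Real.pi)))) :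
    IsClosed (spectralNullSubspace U 𝒜 : Set H) := by
  refine isClosed_of_closure_subset fun x hx A hA => ?_
  obtain ⟨u, hu, hlim⟩ := mem_closure_iff_seq_limit.1 hx
  have bound : ∀ n, unitarySpectralMeasure U x A ≤
      ENNReal.ofReal (‖x - u n‖ ^ 2) + ENNReal.ofReal (‖x - u n‖ ^ 2) := by
    intro n
    have h1 := unitarySpectralMeasure_add_le U (u n) (x - u n) A
    have h2 : unitarySpectralMeasure U (u n) A = 0 := hu n A hA
    rw [add_sub_cancel] at h1
    refine h1.trans ?_
    simp only [Measure.add_apply, h2, zero_add]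
    rw [← unitarySpectralMeasure_univ U]
    exact add_le_add (measure_mono (Set.subset_univ _)) (measure_mono (Set.subset_univ _))
  have lim : Filter.Tendsto (fun n => ENNReal.ofReal (‖x - u n‖ ^ 2)) Filter.atTop (nhds 0) := by
    have h0 : Filter.Tendsto (fun n => ‖x - u n‖ ^ 2) Filter.atTop (nhds (‖x - x‖ ^ 2)) :=
      ((tendsto_const_nhds.sub hlim).norm).pow 2
    simpa using ENNReal.tendsto_ofReal h0
  have lim2 := lim.add lim
  rw [add_zero] at lim2
  exact le_antisymm (ge_of_tendsto' lim2 bound) zero_le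

/-- The singular subspace of a unitary operator, as a linear subspace. -/
noncomputable def unitarySingularSubmodule (U : H ≃ₗᵢ[ℂ] H) : Submodule ℂ H where
  carrier := unitarySingularSubspace U
  zero_mem' := by
    rw [mem_unitarySingularSubspace_iff, unitarySpectralMeasure_zero]
    exact Measure.MutuallySingular.zero_left
  add_mem' := fun {x y} hx hy => by
    rw [mem_unitarySingularSubspace_iff] at *
    exact ((hx.add_left hx).add_left (hy.add_left hy)).mono_ac
      (unitarySpectralMeasure_add_le U x y).absolutelyContinuous Measure.AbsolutelyContinuous.rfl
  smul_mem' := fun c x hx => by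
    rw [mem_unitarySingularSubspace_iff] at *
    rw [unitarySpectralMeasure_smul]
    exact hx.smul_nnreal _

theorem mem_unitarySingularSubmodule_iff {U : H ≃ₗᵢ[ℂ] H} {x : H} :
    x ∈ unitarySingularSubmodule U ↔
      unitarySpectralMeasure U x ⟂ₘ (volume : Measure (AddCircle (2 * Real.pi))) :=
  mem_unitarySingularSubspace_iff

theorem isReducing_unitarySingularSubmodule (U : H ≃ₗᵢ[ℂ] H) :
    IsReducing U (unitarySingularSubmodule U) := by
  refine isReducing_of_zpow fun n x hx => ?_
  rw [mem_unitarySingularSubmodule_iff, unitarySpectralMeasure_map]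
  exact mem_unitarySingularSubmodule_iff.1 hx

theorem isClosed_unitarySingularSubmodule (U : H ≃ₗᵢ[ℂ] H) :
    IsClosed (unitarySingularSubmodule U : Set H) := by
  refine isClosed_of_closure_subset fun x hx => ?_
  obtain ⟨u, hu, hlim⟩ := mem_closure_iff_seq_limit.1 hx
  have hs : ∀ n, unitarySpectralMeasure U (u n) ⟂ₘ
      (volume : Measure (AddCircle (2 * Real.pi))) := fun n =>
    mem_unitarySingularSubmodule_iff.1 (hu n)
  -- One set serves the whole sequence: A is null for every u n, hence for the limit x, while its
  -- complement is a countable union of Lebesgue null sets.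
  let A : Set (AddCircle (2 * Real.pi)) := ⋂ n, (hs n).nullSet
  have hA : MeasurableSet A := MeasurableSet.iInter fun n => (hs n).measurableSet_nullSet
  have hxA : x ∈ spectralNullSubspace U {A} := by
    refine (isClosed_spectralNullSubspace U {A}).mem_of_tendsto hlim
      (Filter.Eventually.of_forall fun n => ?_)
    rintro _ rfl
    exact measure_mono_null (Set.iInter_subset _ n) (hs n).measure_nullSet
  refine mem_unitarySingularSubmodule_iff.2 ⟨A, hA, hxA A rfl, ?_⟩
  rw [Set.compl_iInter]
  exact measure_iUnion_null fun n => (hs n).measure_compl_nullSet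

end SpectralMeasure

/-! ### Measures dominated by a spectral measure; the telescoping identity -/

section RankOne

variable {H : Type*} [NormedAddCommGroup H] [InnerProductSpace ℂ H]

/-- A linear functional dominated by the norm of a linear image is given by an inner product. -/
theorem exists_inner_eq_of_norm_le [CompleteSpace H] {E : Type*} [AddCommGroup E] [Module ℂ E]
    (A : E →ₗ[ℂ] H) (ℓ : E →ₗ[ℂ] ℂ) (C : ℝ) (h : ∀ p, ‖ℓ p‖ ≤ C * ‖A p‖) :
    ∃ d : H, ∀ p, ⟪d, A p⟫_ℂ = ℓ p := by
  -- The bound forces ℓ to vanish on ker A, so ℓ factors through the range of A; the section g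
  -- expresses the factor. Hahn–Banach and Riesz then provide d.
  obtain ⟨g, hg⟩ := A.rangeRestrict.exists_rightInverse_of_surjective A.range_rangeRestrict
  have hg' : ∀ y : LinearMap.range A, A (g y) = y := fun y =>
    congrArg Subtype.val (LinearMap.congr_fun hg y)
  let f : LinearMap.range A →L[ℂ] ℂ := (ℓ.comp g).mkContinuous C fun y => by
    refine (h (g y)).trans_eq ?_
    rw [hg']
    rfl
  obtain ⟨F, hF, -⟩ := exists_extension_norm_eq _ f
  refine ⟨(InnerProductSpace.toDual ℂ H).symm F, fun p => ?_⟩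
  rw [InnerProductSpace.toDual_symm_apply]
  have h1 : F (A p) = ℓ (g (A.rangeRestrict p)) := hF (A.rangeRestrict p)
  have h2 : ‖ℓ (p - g (A.rangeRestrict p))‖ ≤ 0 := by
    refine (h _).trans_eq ?_
    rw [map_sub, hg']
    simp
  have h3 := norm_le_zero_iff.1 h2
  rw [map_sub, sub_eq_zero] at h3
  rw [h1, h3]

/-- Cauchy–Schwarz, from the discriminant of the nonnegative quadratic s ↦ ∫ (‖f‖ - s)² dτ. -/
theorem sq_integral_norm_le (τ : Measure (AddCircle (2 * Real.pi))) [IsFiniteMeasure τ]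
    (f : C(AddCircle (2 * Real.pi), ℂ)) :
    (∫ t, ‖f t‖ ∂τ) ^ 2 ≤ τ.real Set.univ * ∫ t, ‖f t‖ ^ 2 ∂τ := by
  have i1 : Integrable (fun t => ‖f t‖) τ :=
    (by fun_prop : Continuous fun t => ‖f t‖).integrable_of_hasCompactSupport
      (HasCompactSupport.of_compactSpace _)
  have i2 : Integrable (fun t => ‖f t‖ ^ 2) τ :=
    (by fun_prop : Continuous fun t => ‖f t‖ ^ 2).integrable_of_hasCompactSupport
      (HasCompactSupport.of_compactSpace _)
  have key : ∀ s : ℝ, 0 ≤ τ.real Set.univ * (s * s) + (-2 * ∫ t, ‖f t‖ ∂τ) * s +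
      ∫ t, ‖f t‖ ^ 2 ∂τ := by
    intro s
    have h0 : 0 ≤ ∫ t, (‖f t‖ ^ 2 - 2 * s * ‖f t‖ + s * s) ∂τ :=
      integral_nonneg fun t => by
        change 0 ≤ ‖f t‖ ^ 2 - 2 * s * ‖f t‖ + s * s
        nlinarith [sq_nonneg (‖f t‖ - s)]
    have i3 : Integrable (fun t => ‖f t‖ ^ 2 - 2 * s * ‖f t‖) τ := i2.sub (i1.const_mul _)
    rw [integral_add i3 (integrable_const _),
      integral_sub i2 (i1.const_mul _), integral_const_mul, integral_const, smul_eq_mul] at h0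
    linarith
  have := discrim_le_zero key
  rw [discrim] at this
  linarith

variable [CompleteSpace H]

/-- A measure dominated by the spectral measure of `x` is of the form
`k ↦ ⟪x, U ^ k d⟫` on the monomials. -/
theorem exists_inner_zpow_eq_integral_fourier (U : H ≃ₗᵢ[ℂ] H) (x : H)
    {τ : Measure (AddCircle (2 * Real.pi))} {C : NNReal} (h : τ ≤ C • unitarySpectralMeasure U x) :
    ∃ d : H, ∀ n : ℤ, ⟪x, (U ^ n) d⟫_ℂ = ∫ t, fourier n t ∂τ := by
  have hτ : IsFiniteMeasure τ := isFiniteMeasure_of_le _ h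
  -- Cauchy–Schwarz and the domination give |∫ f dτ|² ≤ τ(𝕋) C ‖f(U)x‖², so the integral is a
  -- bounded functional of f(U)x.
  obtain ⟨d, hd⟩ := exists_inner_eq_of_norm_le
    ((ContinuousLinearMap.apply ℂ H x).toLinearMap ∘ₗ (unitaryCalculus U).toAlgHom.toLinearMap)
    (circleIntegralCLM τ).toLinearMap (Real.sqrt (τ.real Set.univ * C)) (fun f => by
      change ‖∫ t, f t ∂τ‖ ≤ Real.sqrt (τ.real Set.univ * C) * ‖unitaryCalculus U f x‖
      refine abs_le_of_sq_le_sq' ?_ (by positivity) |>.2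
      rw [mul_pow, Real.sq_sqrt (by positivity),
        ← (isUnitarySpectralMeasure_unitarySpectralMeasure U x).integral_norm_sq, mul_assoc]
      have h1 : ‖∫ t, f t ∂τ‖ ^ 2 ≤ (∫ t, ‖f t‖ ∂τ) ^ 2 :=
        pow_le_pow_left₀ (norm_nonneg _) (norm_integral_le_integral_norm _) 2
      refine h1.trans ((sq_integral_norm_le τ f).trans ?_)
      refine mul_le_mul_of_nonneg_left ?_ measureReal_nonneg
      have h2 := integral_mono_measure (f := fun t => ‖f t‖ ^ 2) h
        (Filter.Eventually.of_forall fun t => by positivity)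
        ((by fun_prop : Continuous fun t => ‖f t‖ ^ 2).integrable_of_hasCompactSupport
          (HasCompactSupport.of_compactSpace _))
      rwa [integral_smul_nnreal_measure] at h2)
  refine ⟨d, fun n => ?_⟩
  have h1 : ⟪d, (U ^ (-n)) x⟫_ℂ = ∫ t, fourier (-n) t ∂τ := by
    rw [← unitaryCalculus_fourier]
    exact hd (fourier (-n))
  rw [unitary_inner_zpow, ← inner_conj_symm, h1, conj_integral_fourier, neg_neg]

omit [CompleteSpace H] in
/-- The telescoping identity behind the mutual singularity of the singular parts. -/
theorem sum_norm_sq_le_of_rankOne {V W : H ≃ₗᵢ[ℂ] H} {φ : H} {c : ℂ}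
    (hWV : ∀ x, W x = V x + (c * ⟪φ, x⟫_ℂ) • W φ) {a b : H} {m : ℤ → ℂ}
    (ha : ∀ k : ℤ, ⟪φ, (V ^ k) a⟫_ℂ = m k) (hb : ∀ k : ℤ, ⟪φ, (W ^ k) b⟫_ℂ = m k) (n : ℕ) :
    ‖c‖ * ∑ j ∈ Finset.range n, ‖m j‖ ^ 2 ≤ 2 * (‖a‖ * ‖b‖) := by
  -- This pairing would be constant in j if W = V; the rank one term makes each step lose exactly
  -- c‖m j‖².
  let G : ℕ → ℂ := fun j => ⟪(W ^ (j : ℤ)) b, (V ^ (j : ℤ)) a⟫_ℂ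
  have hG : ∀ j, ‖G j‖ ≤ ‖a‖ * ‖b‖ := by
    intro j
    refine (norm_inner_le_norm _ _).trans_eq ?_
    rw [LinearIsometryEquiv.norm_map, LinearIsometryEquiv.norm_map, mul_comm]
  have step : ∀ j, G j - G (j + 1) = c * ((‖m j‖ ^ 2 : ℝ) : ℂ) := by
    intro j
    have h1 : (V ^ ((j : ℤ) + 1)) a =
        W ((V ^ (j : ℤ)) a) - (c * ⟪φ, (V ^ (j : ℤ)) a⟫_ℂ) • W φ := by
      rw [unitary_zpow_succ_apply, hWV ((V ^ (j : ℤ)) a)]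
      abel
    have h2 : ⟪(W ^ (j : ℤ)) b, φ⟫_ℂ = (starRingEnd ℂ) (m j) := by
      rw [← inner_conj_symm, hb]
    simp only [G, Nat.cast_add, Nat.cast_one]
    rw [h1, unitary_zpow_succ_apply, inner_sub_right, inner_smul_right,
      LinearIsometryEquiv.inner_map_map, LinearIsometryEquiv.inner_map_map, h2, ha, sub_sub_cancel,
      mul_assoc, Complex.mul_conj', Complex.ofReal_pow]
  have hsum : c * ((∑ j ∈ Finset.range n, ‖m j‖ ^ 2 : ℝ) : ℂ) = G 0 - G n := by
    rw [← Finset.sum_range_sub' G n, Complex.ofReal_sum, Finset.mul_sum]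
    exact Finset.sum_congr rfl fun j _ => (step j).symm
  have hnorm := congrArg norm hsum
  rw [norm_mul, Complex.norm_real, Real.norm_of_nonneg
    (Finset.sum_nonneg fun j _ => by positivity)] at hnorm
  rw [hnorm]
  linarith [norm_sub_le (G 0) (G n), hG 0, hG n]

end RankOne

/-! ### Square summable moments imply absolute continuity -/

section FourierSquareSummable

open AddCircle

/-- A finite measure on the circle with square summable moments is absolutely continuous. -/
theorem absolutelyContinuous_of_summable_sq (τ : Measure (AddCircle (2 * Real.pi)))
    [IsFiniteMeasure τ] {B : ℝ}
    (hB : ∀ n : ℕ, ∑ j ∈ Finset.range n, ‖∫ t, fourier (j : ℤ) t ∂τ‖ ^ 2 ≤ B) :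
    τ ≪ (volume : Measure (AddCircle (2 * Real.pi))) := by
  have hnat : Summable fun j : ℕ => ‖∫ t, fourier (j : ℤ) t ∂τ‖ ^ 2 :=
    summable_of_sum_range_le (fun _ => by positivity) hB
  -- Positivity of τ makes opposite moments conjugate, so the bound on nonnegative indices is
  -- enough.
  have hneg : ∀ n : ℤ, ‖∫ t, fourier (-n) t ∂τ‖ = ‖∫ t, fourier n t ∂τ‖ := by
    intro n
    rw [← conj_integral_fourier, RCLike.norm_conj]
  have hint : Summable fun n : ℤ => ‖∫ t, fourier (-n) t ∂τ‖ ^ 2 := by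
    simp only [hneg]
    refine Summable.of_nat_of_neg hnat ?_
    simpa only [hneg] using hnat
  have hmem : Memℓp (fun n : ℤ => ∫ t, fourier (-n) t ∂τ) 2 := by
    refine memℓp_gen ?_
    simpa using hint
  let f : Lp ℂ 2 (@haarAddCircle (2 * Real.pi) _) := fourierBasis.repr.symm ⟨_, hmem⟩
  have hfi : Integrable f haarAddCircle := (Lp.memLp f).integrable one_le_two
  have hf : ∀ n : ℤ, ∫ t, fourier n t * f t ∂haarAddCircle = ∫ t, fourier n t ∂τ := by
    intro n
    have h1 : fourierBasis.repr f (-n) = ∫ t, fourier n t ∂τ := by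
      simp only [f, LinearIsometryEquiv.apply_symm_apply, neg_neg]
    rw [fourierBasis_repr, fourierCoeff, neg_neg] at h1
    exact h1
  have hmul : ∀ (n : ℤ) {g : AddCircle (2 * Real.pi) → ℂ}, Integrable g haarAddCircle →
      Integrable (fun t => fourier n t * g t) haarAddCircle := by
    intro n g hg
    refine hg.bdd_mul (c := 1) (fourier n).continuous.aestronglyMeasurable
      (Filter.Eventually.of_forall fun t => ?_)
    exact ((fourier n).norm_coe_le_norm t).trans_eq (fourier_norm n)
  -- The conjugate of f has the same moments as f, hence so does the real part r.
  let r : AddCircle (2 * Real.pi) → ℝ := fun t => (f t).re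
  have hri : Integrable r haarAddCircle := hfi.re
  have hr : ∀ n : ℤ, ∫ t, fourier n t * (r t : ℂ) ∂haarAddCircle = ∫ t, fourier n t ∂τ := by
    intro n
    have hconj : ∫ t, fourier n t * (starRingEnd ℂ) (f t) ∂haarAddCircle =
        ∫ t, fourier n t ∂τ := by
      rw [← neg_neg n, ← conj_integral_fourier τ (-n), ← hf (-n), ← integral_conj]
      simp only [map_mul, fourier_neg, Complex.conj_conj]
    have hci : Integrable (fun t => (starRingEnd ℂ) (f t)) haarAddCircle :=
      hfi.mono (Complex.continuous_conj.comp_aestronglyMeasurable hfi.1)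
        (Filter.Eventually.of_forall fun t => (RCLike.norm_conj (f t)).le)
    have e : ∀ t, fourier n t * (r t : ℂ) =
        (1 / 2 : ℂ) * (fourier n t * f t + fourier n t * (starRingEnd ℂ) (f t)) := by
      intro t
      have : (r t : ℂ) = (f t + (starRingEnd ℂ) (f t)) / 2 := Complex.re_eq_add_conj _
      rw [this]
      ring
    simp only [e]
    rw [integral_const_mul, integral_add (hmul n hfi) (hmul n hci), hf, hconj]
    ring
  let P : Measure (AddCircle (2 * Real.pi)) :=
    haarAddCircle.withDensity fun t => ENNReal.ofReal (r t)
  let N : Measure (AddCircle (2 * Real.pi)) :=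
    haarAddCircle.withDensity fun t => ENNReal.ofReal (-r t)
  have hP : IsFiniteMeasure P := isFiniteMeasure_withDensity_ofReal hri.2
  have hN : IsFiniteMeasure N := isFiniteMeasure_withDensity_ofReal hri.neg.2
  have dens : ∀ s : AddCircle (2 * Real.pi) → ℝ, Integrable s haarAddCircle → ∀ n : ℤ,
      ∫ t, fourier n t ∂(haarAddCircle.withDensity fun t => ENNReal.ofReal (s t)) =
        ∫ t, fourier n t * ((max (s t) 0 : ℝ) : ℂ) ∂haarAddCircle := by
    intro s hs n
    rw [integral_withDensity_eq_integral_toReal_smul₀ hs.1.aemeasurable.ennreal_ofReal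
      (Filter.Eventually.of_forall fun t => ENNReal.ofReal_lt_top)]
    simp only [ENNReal.toReal_ofReal', Complex.real_smul, mul_comm]
  have hneg_part : Integrable (fun t => max (-r t) 0) haarAddCircle := hri.neg.pos_part
  -- Moments determine positive measures only, so the negative part of r is moved to the side of τ;
  -- no sign of r is needed.
  have heq : τ + N = P := by
    refine measure_ext_fourier fun n => ?_
    rw [integral_fourier_add_measure, dens (fun t => -r t) hri.neg, dens r hri, ← hr n,
      ← integral_add (hmul n (g := fun t => (r t : ℂ)) hri.ofReal)
        (hmul n (g := fun t => ((max (-r t) 0 : ℝ) : ℂ)) hneg_part.ofReal)]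
    refine integral_congr_ae (Filter.Eventually.of_forall fun t => ?_)
    have : r t + max (-r t) 0 = max (r t) 0 := by
      rcases le_total (r t) 0 with h | h
      · rw [max_eq_left (by linarith), max_eq_right h]
        ring
      · rw [max_eq_right (by linarith), max_eq_left h]
        ring
    change fourier n t * (r t : ℂ) + fourier n t * ((max (-r t) 0 : ℝ) : ℂ) = _
    rw [← mul_add, ← Complex.ofReal_add, this]
  have hle : τ ≤ P := by
    rw [← heq]
    exact Measure.le_add_right le_rfl
  have hPv : P ≪ (volume : Measure (AddCircle (2 * Real.pi))) := by
    refine (withDensity_absolutelyContinuous _ _).trans ?_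
    rw [volume_eq_smul_haarAddCircle]
    exact Measure.absolutelyContinuous_smul (by simp [Real.pi_pos])
  exact hle.absolutelyContinuous.trans hPv

end FourierSquareSummable

/-! ### Rank one perturbations and the abstract criterion -/

section Abstract

variable {H : Type*} [NormedAddCommGroup H] [InnerProductSpace ℂ H]

/-- The normal form of a unitary rank one perturbation of a unitary operator. -/
theorem exists_rankOne_form {V W : H ≃ₗᵢ[ℂ] H} {φ : H} (h : ∀ x, ⟪φ, x⟫_ℂ = 0 → W x = V x)
    (hne : ∃ x, W x ≠ V x) :
    ∃ c : ℂ, c ≠ 0 ∧ ∀ x, W x = V x + (c * ⟪φ, x⟫_ℂ) • W φ := by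
  obtain ⟨x₀, hx₀⟩ := hne
  have hφ : φ ≠ 0 := by
    rintro rfl
    exact hx₀ (h x₀ (inner_zero_left _))
  have hφ2 : ⟪φ, φ⟫_ℂ ≠ 0 := inner_self_ne_zero.2 hφ
  have perp : ∀ x, ⟪φ, x - (⟪φ, x⟫_ℂ / ⟪φ, φ⟫_ℂ) • φ⟫_ℂ = 0 := by
    intro x
    rw [inner_sub_right, inner_smul_right, div_mul_cancel₀ _ hφ2, sub_self]
  -- The component x of y = V⁻¹Wφ orthogonal to φ vanishes: ⟪y, x⟫ = ⟪Wφ, Vx⟫ = ⟪Wφ, Wx⟫ = ⟪φ, x⟫ =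
  -- 0.
  obtain ⟨k, hk⟩ : ∃ k : ℂ, V.symm (W φ) = k • φ := by
    let y := V.symm (W φ)
    let x := y - (⟪φ, y⟫_ℂ / ⟪φ, φ⟫_ℂ) • φ
    have hx : ⟪φ, x⟫_ℂ = 0 := perp y
    have hyx : ⟪y, x⟫_ℂ = 0 := by
      rw [← V.inner_map_map, V.apply_symm_apply, ← h x hx, W.inner_map_map, hx]
    have hxx : ⟪x, x⟫_ℂ = 0 := by
      change ⟪y - (⟪φ, y⟫_ℂ / ⟪φ, φ⟫_ℂ) • φ, x⟫_ℂ = 0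
      rw [inner_sub_left, inner_smul_left, hyx, hx, mul_zero, sub_zero]
    exact ⟨_, sub_eq_zero.1 (inner_self_eq_zero.1 hxx)⟩
  have hW : W φ = k • V φ := by
    rw [← map_smul, ← hk, V.apply_symm_apply]
  have hk0 : k ≠ 0 := by
    rintro rfl
    rw [zero_smul, map_eq_zero_iff _ W.injective] at hW
    exact hφ hW
  have hV : V φ = k⁻¹ • W φ := by
    rw [hW, smul_smul, inv_mul_cancel₀ hk0, one_smul]
  have form : ∀ x, W x = V x + (((1 - k⁻¹) / ⟪φ, φ⟫_ℂ) * ⟪φ, x⟫_ℂ) • W φ := by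
    intro x
    have h1 := h _ (perp x)
    rw [map_sub, map_sub, map_smul, map_smul, hV, sub_eq_iff_eq_add] at h1
    rw [h1]
    module
  refine ⟨_, fun hc => hx₀ ?_, form⟩
  rw [form x₀, hc, zero_mul, zero_smul, add_zero]

theorem symm_apply_of_rankOne {V W : H ≃ₗᵢ[ℂ] H} {φ : H} {c : ℂ}
    (hWV : ∀ x, W x = V x + (c * ⟪φ, x⟫_ℂ) • W φ) (x : H) :
    V.symm x = W.symm x + (c * ⟪φ, V.symm x⟫_ℂ) • φ := by
  apply W.injective
  rw [map_add, map_smul, W.apply_symm_apply]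
  nth_rw 1 [hWV (V.symm x)]
  rw [V.apply_symm_apply]

/-- V and W differ by multiples of Wφ, their inverses by multiples of φ, and K contains both
vectors. -/
theorem IsReducing.of_rankOne {V W : H ≃ₗᵢ[ℂ] H} {φ : H} {c : ℂ}
    (hWV : ∀ x, W x = V x + (c * ⟪φ, x⟫_ℂ) • W φ) {K : Submodule ℂ H} (hK : IsReducing W K)
    (hφ : φ ∈ K) : IsReducing V K := by
  refine fun x hx => ⟨?_, ?_⟩
  · rw [← sub_eq_iff_eq_add.2 (hWV x)]
    exact K.sub_mem (hK x hx).1 (K.smul_mem _ (hK φ hφ).1)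
  · rw [symm_apply_of_rankOne hWV]
    exact K.add_mem (hK x hx).2 (K.smul_mem _ hφ)

/-- On the orthogonal complement of the cyclic subspace of `φ` the perturbation is not felt. -/
theorem zpow_eq_of_mem_orthogonal {V W : H ≃ₗᵢ[ℂ] H} {φ : H}
    (h : ∀ x, ⟪φ, x⟫_ℂ = 0 → W x = V x) {z : H} (hz : z ∈ (unitaryCyclicSubspace V φ)ᗮ) (n : ℤ) :
    (W ^ n) z = (V ^ n) z := by
  have hV : ∀ n : ℤ, W ((V ^ n) z) = V ((V ^ n) z) := fun n =>
    h _ ((isReducing_unitaryCyclicSubspace V φ).orthogonal.zpow_mem hz n _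
      (self_mem_unitaryCyclicSubspace V φ))
  induction n with
  | zero => simp
  | succ n ih => rw [unitary_zpow_succ_apply, ih, hV, unitary_zpow_succ_apply]
  | pred n ih =>
    apply W.injective
    rw [hV, ← unitary_zpow_succ_apply, ← unitary_zpow_succ_apply, sub_add_cancel, ih]

variable [CompleteSpace H]

/-- If the spectral measures of `a` and `b` are mutually singular, then `a + b` generates `a`. -/
theorem mem_unitaryCyclicSubspace_add_of_mutuallySingular {U : H ≃ₗᵢ[ℂ] H} {a b : H}
    (h : unitarySpectralMeasure U a ⟂ₘ unitarySpectralMeasure U b) :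
    a ∈ unitaryCyclicSubspace U (a + b) := by
  let μ := unitarySpectralMeasure U a + unitarySpectralMeasure U b
  -- The indicator of a set carrying the measure of a and null for that of b. If a continuous f is
  -- close to g in L²(μ), then f(U)(a + b) is close to a.
  let g : AddCircle (2 * Real.pi) → ℂ := h.nullSetᶜ.indicator 1
  have hg : MemLp g (ENNReal.ofReal 2) μ :=
    (memLp_const (1 : ℂ)).indicator h.measurableSet_nullSet.compl
  have hga : g =ᵐ[unitarySpectralMeasure U a] fun _ => 1 := by
    have : ∀ᵐ t ∂(unitarySpectralMeasure U a), t ∈ h.nullSetᶜ := by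
      rw [ae_iff]
      simp
    filter_upwards [this] with t ht
    simp only [g, Set.indicator_of_mem ht, Pi.one_apply]
  have hgb : g =ᵐ[unitarySpectralMeasure U b] fun _ => 0 := by
    have : ∀ᵐ t ∂(unitarySpectralMeasure U b), t ∉ h.nullSetᶜ := by
      rw [ae_iff]
      simp only [not_not]
      exact h.measure_compl_nullSet
    filter_upwards [this] with t ht
    simp only [g, Set.indicator_of_notMem ht]
  refine (isClosed_unitaryCyclicSubspace U (a + b)).closure_subset_iff.2 subset_rfl
    (Metric.mem_closure_iff.2 fun δ hδ => ?_)
  obtain ⟨f, hf, hfL⟩ := hg.exists_boundedContinuous_integral_rpow_sub_le two_pos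
    (ε := (δ / 4) ^ 2) (by positivity)
  simp only [Real.rpow_two] at hf
  have hint : Integrable (fun t => ‖g t - f t‖ ^ 2) μ := by
    have := (hg.sub hfL).integrable_norm_rpow (by simp) (by simp)
    simpa using this
  rw [integral_add_measure hint.left_of_add_measure hint.right_of_add_measure] at hf
  have ia : ∫ t, ‖g t - f t‖ ^ 2 ∂(unitarySpectralMeasure U a) =
      ‖unitaryCalculus U (1 - f.toContinuousMap) a‖ ^ 2 := by
    rw [← (isUnitarySpectralMeasure_unitarySpectralMeasure U a).integral_norm_sq]
    refine integral_congr_ae ?_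
    filter_upwards [hga] with t ht
    rw [ht]
    rfl
  have ib : ∫ t, ‖g t - f t‖ ^ 2 ∂(unitarySpectralMeasure U b) =
      ‖unitaryCalculus U f.toContinuousMap b‖ ^ 2 := by
    rw [← (isUnitarySpectralMeasure_unitarySpectralMeasure U b).integral_norm_sq]
    refine integral_congr_ae ?_
    filter_upwards [hgb] with t ht
    rw [ht, zero_sub, norm_neg]
    rfl
  rw [ia, ib] at hf
  have na := abs_le_of_sq_le_sq' (le_trans (le_add_of_nonneg_right (sq_nonneg _)) hf)
    (by positivity)
  have nb := abs_le_of_sq_le_sq' (le_trans (le_add_of_nonneg_left (sq_nonneg _)) hf)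
    (by positivity)
  refine ⟨_, unitaryCalculus_mem_unitaryCyclicSubspace U f.toContinuousMap (a + b), ?_⟩
  have e : a - unitaryCalculus U f.toContinuousMap (a + b) =
      unitaryCalculus U (1 - f.toContinuousMap) a - unitaryCalculus U f.toContinuousMap b := by
    rw [map_sub, map_one, map_add, sub_apply, one_apply_eq_self]
    abel
  rw [dist_eq_norm, e]
  linarith [norm_sub_le (unitaryCalculus U (1 - f.toContinuousMap) a)
    (unitaryCalculus U f.toContinuousMap b), na.2, nb.2]

/-- The spectral measure of the singular part of `φ` under the perturbed operator is singular
with respect to the spectral measure of `φ` under the original operator. -/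
theorem mutuallySingular_of_rankOne {V W : H ≃ₗᵢ[ℂ] H} {φ : H} {c : ℂ} (hc : c ≠ 0)
    (hWV : ∀ x, W x = V x + (c * ⟪φ, x⟫_ℂ) • W φ)
    [(unitarySingularSubmodule W).HasOrthogonalProjection] :
    unitarySpectralMeasure W ((unitarySingularSubmodule W).starProjection φ) ⟂ₘ
      unitarySpectralMeasure V φ := by
  by_contra hns
  obtain ⟨ε, hε, E, hE, hpos, hle⟩ := Measure.exists_positive_of_not_mutuallySingular _ _ hns
  let P := (unitarySingularSubmodule W).starProjection
  -- The nonzero common minorant of the two measures, up to the factor ε.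
  let τ := ε • (unitarySpectralMeasure V φ).restrict E
  have hτV : τ ≤ ε • unitarySpectralMeasure V φ := by
    refine Measure.le_iff'.2 fun A => ?_
    simp only [τ, Measure.smul_apply]
    gcongr
    exact Measure.restrict_le_self
  have hτW : τ ≤ unitarySpectralMeasure W (P φ) := by
    refine Measure.le_iff.2 fun A hA => ?_
    rw [Measure.smul_apply, Measure.restrict_apply hA]
    exact (hle A hA).trans (measure_mono Set.inter_subset_left)
  obtain ⟨a, ha⟩ := exists_inner_zpow_eq_integral_fourier V φ hτV
  obtain ⟨b, hb⟩ := exists_inner_zpow_eq_integral_fourier W (P φ) (τ := τ) (C := 1)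
    (by rwa [one_smul])
  -- Moving P from φ to b leaves φ itself in the moments, as the telescoping identity requires.
  have hb' : ∀ n : ℤ, ⟪φ, (W ^ n) (P b)⟫_ℂ = ∫ t, fourier n t ∂τ := by
    intro n
    rw [← hb, ← (isReducing_unitarySingularSubmodule W).starProjection_zpow]
    exact (Submodule.inner_starProjection_left_eq_right _ _ _).symm
  have hac : τ ≪ (volume : Measure (AddCircle (2 * Real.pi))) := by
    refine absolutelyContinuous_of_summable_sq τ (B := 2 * (‖a‖ * ‖P b‖) / ‖c‖) fun n => ?_
    rw [le_div_iff₀' (norm_pos_iff.2 hc)]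
    exact sum_norm_sq_le_of_rankOne hWV ha hb' n
  have hsing : τ ⟂ₘ (volume : Measure (AddCircle (2 * Real.pi))) :=
    (mem_unitarySingularSubmodule_iff.1 (Submodule.starProjection_apply_mem _ φ)).mono_ac
      hτW.absolutelyContinuous Measure.AbsolutelyContinuous.rfl
  have hzero : τ = 0 := Measure.eq_zero_of_absolutelyContinuous_of_mutuallySingular hac hsing
  have hEτ : τ E = ε * unitarySpectralMeasure V φ E := by
    rw [Measure.smul_apply, Measure.restrict_apply_self]
    rfl
  rw [hzero, Measure.coe_zero, Pi.zero_apply] at hEτ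
  exact (ENNReal.mul_pos (by simpa using hε.ne') hpos.ne').ne hEτ

/-- A unitary rank one perturbation has simple singular spectrum if the vector `φ` of the
perturbation has maximal spectral type and together with one more vector generates the space. -/
theorem hasSimpleSingularSpectrum_of_rankOne {V W : H ≃ₗᵢ[ℂ] H} {φ e : H}
    (h : ∀ x, ⟪φ, x⟫_ℂ = 0 → W x = V x) (hne : ∃ x, W x ≠ V x)
    (hgen : ∀ K : Submodule ℂ H, IsClosed (K : Set H) → IsReducing V K → φ ∈ K → e ∈ K → K = ⊤)
    (hmax : ∀ x, unitarySpectralMeasure V x ≪ unitarySpectralMeasure V φ) :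
    HasSimpleSingularSpectrum W := by
  obtain ⟨c, hc, hWV⟩ := exists_rankOne_form h hne
  let S := unitarySingularSubmodule W
  have hS : IsReducing W S := isReducing_unitarySingularSubmodule W
  have : CompleteSpace S := (isClosed_unitarySingularSubmodule W).completeSpace_coe
  let M := unitaryCyclicSubspace V φ
  have hM : IsReducing V M := isReducing_unitaryCyclicSubspace V φ
  have : CompleteSpace M := (isClosed_unitaryCyclicSubspace V φ).completeSpace_coe
  let P := S.starProjection
  let Q := Mᗮ.starProjection
  have hQ : ∀ x, Q x ∈ Mᗮ := fun x => Submodule.starProjection_apply_mem _ x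
  let ψ := P φ + P (Q e)
  -- Projecting by P only shrinks the measure, and on Mᗮ the spectral measures of W and V agree.
  have hb : unitarySpectralMeasure W (P (Q e)) ≪ unitarySpectralMeasure V φ := by
    refine (hS.unitarySpectralMeasure_starProjection_le (Q e)).absolutelyContinuous.trans ?_
    rw [unitarySpectralMeasure_congr (zpow_eq_of_mem_orthogonal h (hQ e))]
    exact hmax _
  have ha : P φ ∈ unitaryCyclicSubspace W ψ :=
    mem_unitaryCyclicSubspace_add_of_mutuallySingular
      ((mutuallySingular_of_rankOne hc hWV).mono_ac Measure.AbsolutelyContinuous.rfl hb)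
  have hb' : P (Q e) ∈ unitaryCyclicSubspace W ψ := by
    have := (unitaryCyclicSubspace W ψ).sub_mem (self_mem_unitaryCyclicSubspace W ψ) ha
    rwa [add_sub_cancel_left] at this
  let N := unitaryCyclicSubspace W ψ
  have hN : IsReducing W N := isReducing_unitaryCyclicSubspace W ψ
  have hNc : IsClosed (N : Set H) := isClosed_unitaryCyclicSubspace W ψ
  -- The preimage of N under P is reducing for W and contains φ, hence is reducing for V as well and
  -- contains M.
  have hML : M ≤ N.comap P.toLinearMap := by
    have hL : IsReducing W (N.comap P.toLinearMap) := isReducing_of_zpow fun n x hx => by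
      change P ((W ^ n) x) ∈ N
      rw [hS.starProjection_zpow]
      exact hN.zpow_mem hx n
    exact (hL.of_rankOne hWV ha).unitaryCyclicSubspace_le (hNc.preimage P.continuous) ha
  -- This preimage is reducing for V because V = W on the range of Q; it contains φ since Qφ = 0.
  have hL' : N.comap (P ∘L Q).toLinearMap = ⊤ := by
    refine hgen _ (hNc.preimage (P ∘L Q).continuous) (isReducing_of_zpow fun n x hx => ?_) ?_ hb'
    · change P (Q ((V ^ n) x)) ∈ N
      rw [hM.orthogonal.starProjection_zpow, ← zpow_eq_of_mem_orthogonal h (hQ x),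
        hS.starProjection_zpow]
      exact hN.zpow_mem hx n
    · change P (Q φ) ∈ N
      have : Q φ = 0 := (Submodule.starProjection_apply_eq_zero_iff _).2
        (Submodule.le_orthogonal_orthogonal M (self_mem_unitaryCyclicSubspace V φ))
      rw [this, map_zero]
      exact N.zero_mem
  refine ⟨ψ, Set.Subset.antisymm ?_ fun x hx => ?_⟩
  · exact hS.unitaryCyclicSubspace_le (isClosed_unitarySingularSubmodule W)
      (S.add_mem (Submodule.starProjection_apply_mem _ _) (Submodule.starProjection_apply_mem _ _))
  · have hx1 : P x = x := Submodule.starProjection_eq_self_iff.2 hx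
    have hx2 : P (M.starProjection x) ∈ N := hML (Submodule.starProjection_apply_mem _ _)
    have hx3 : P (Q x) ∈ N := by
      have : x ∈ N.comap (P ∘L Q).toLinearMap := by
        rw [hL']
        trivial
      exact this
    have := N.add_mem hx2 hx3
    rw [← map_add, Submodule.starProjection_add_starProjection_orthogonal, hx1] at this
    exact this

end Abstract

/-! ### The direct sum -/

section DirectSum

variable {K₁ K₂ : Type*} [NormedAddCommGroup K₁] [InnerProductSpace ℂ K₁]
  [NormedAddCommGroup K₂] [InnerProductSpace ℂ K₂]

/-- The preimage of L under an intertwiner is closed and reducing, and it contains the cyclic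
vector. -/
theorem IsCyclicVector.le_comap {K H : Type*} [NormedAddCommGroup K] [InnerProductSpace ℂ K]
    [NormedAddCommGroup H] [InnerProductSpace ℂ H] {U : K ≃ₗᵢ[ℂ] K} {V : H ≃ₗᵢ[ℂ] H}
    {x : K} (hx : IsCyclicVector U x) (J : K →L[ℂ] H) (hJ : ∀ y, V (J y) = J (U y))
    {L : Submodule ℂ H} (hL : IsReducing V L) (hc : IsClosed (L : Set H)) (h : J x ∈ L) (y : K) :
    J y ∈ L := by
  have hJ' : ∀ y, V.symm (J y) = J (U.symm y) := by
    intro y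
    apply V.injective
    rw [hJ, V.apply_symm_apply, U.apply_symm_apply]
  have hred : IsReducing U (L.comap J.toLinearMap) := by
    refine fun z hz => ⟨?_, ?_⟩
    · change J (U z) ∈ L
      rw [← hJ]
      exact (hL _ hz).1
    · change J (U.symm z) ∈ L
      rw [← hJ']
      exact (hL _ hz).2
  have hle : unitaryCyclicSubspace U x ≤ L.comap J.toLinearMap :=
    hred.unitaryCyclicSubspace_le (hc.preimage J.continuous) h
  refine hle ?_
  rw [hx]
  trivial

theorem inner_inl_zpow_inr (U₁ : K₁ ≃ₗᵢ[ℂ] K₁) (U₂ : K₂ ≃ₗᵢ[ℂ] K₂) (x : K₁) (y : K₂) (n : ℤ) :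
    ⟪WithLp.toLp 2 (x, (0 : K₂)), (unitaryDirectSum U₁ U₂ ^ n) (WithLp.toLp 2 ((0 : K₁), y))⟫_ℂ =
      0 := by
  let F : Submodule ℂ (WithLp 2 (K₁ × K₂)) :=
    { carrier := {z | z.fst = 0}
      zero_mem' := rfl
      add_mem' := fun {a b} ha hb => by
        change a.fst + b.fst = 0
        rw [show a.fst = 0 from ha, show b.fst = 0 from hb, add_zero]
      smul_mem' := fun c a ha => by
        change c • a.fst = 0
        rw [show a.fst = 0 from ha, smul_zero] }
  have hF : IsReducing (unitaryDirectSum U₁ U₂) F := by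
    refine fun z hz => ⟨?_, ?_⟩
    · change U₁ z.fst = 0
      rw [show z.fst = 0 from hz, map_zero]
    · change U₁.symm z.fst = 0
      rw [show z.fst = 0 from hz, map_zero]
  have h0 : ((unitaryDirectSum U₁ U₂ ^ n) (WithLp.toLp 2 ((0 : K₁), y))).fst = 0 :=
    hF.zpow_mem (x := WithLp.toLp 2 ((0 : K₁), y)) rfl n
  rw [WithLp.prod_inner_apply]
  change ⟪x, WithLp.fst _⟫_ℂ + ⟪(0 : K₂), _⟫_ℂ = 0
  rw [h0, inner_zero_right, inner_zero_left, add_zero]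

end DirectSum

theorem theorem4p1 {K₁ K₂ : Type*}
    [NormedAddCommGroup K₁] [InnerProductSpace ℂ K₁] [CompleteSpace K₁]
    [NormedAddCommGroup K₂] [InnerProductSpace ℂ K₂] [CompleteSpace K₂]
    (U₁ : K₁ ≃ₗᵢ[ℂ] K₁) (U₂ : K₂ ≃ₗᵢ[ℂ] K₂)
    (W : WithLp 2 (K₁ × K₂) ≃ₗᵢ[ℂ] WithLp 2 (K₁ × K₂))
    (hrank : (unitaryDifference W (unitaryDirectSum U₁ U₂)).rank = 1)
    (φ : WithLp 2 (K₁ × K₂))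
    (hφ : Submodule.span ℂ {φ} =
      (LinearMap.ker (unitaryDifference W (unitaryDirectSum U₁ U₂)))ᗮ)
    (hφ₁ : IsCyclicVector U₁ φ.fst)
    (hφ₂ : IsCyclicVector U₂ φ.snd) :
    HasSimpleSingularSpectrum W := by
  let V := unitaryDirectSum U₁ U₂
  let D := unitaryDifference W V
  have hD : ∀ x, D x = W x - V x := fun _ => rfl
  have h : ∀ x, ⟪φ, x⟫_ℂ = 0 → W x = V x := by
    have hclosed : IsClosed (LinearMap.ker D : Set (WithLp 2 (K₁ × K₂))) := by
      have : (LinearMap.ker D : Set (WithLp 2 (K₁ × K₂))) = {x | W x = V x} := by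
        ext x
        exact sub_eq_zero
      rw [this]
      exact isClosed_eq W.continuous V.continuous
    -- Completeness makes the kernel equal to its double orthogonal complement, so φᗮ is exactly the
    -- kernel.
    have : CompleteSpace (LinearMap.ker D) := hclosed.completeSpace_coe
    intro x hx
    have hx' : x ∈ (LinearMap.ker D)ᗮᗮ := by
      rw [← hφ, Submodule.mem_orthogonal_singleton_iff_inner_right]
      exact hx
    rw [Submodule.orthogonal_orthogonal] at hx'
    exact sub_eq_zero.1 hx'
  have hne : ∃ x, W x ≠ V x := by
    by_contra! hall
    have : D = 0 := by
      ext1 x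
      rw [hD, hall, sub_self]
      rfl
    rw [show unitaryDifference W (unitaryDirectSum U₁ U₂) = 0 from this,
      LinearMap.rank_zero] at hrank
    exact zero_ne_one hrank
  let J₁ : K₁ →L[ℂ] WithLp 2 (K₁ × K₂) :=
    (WithLp.prodContinuousLinearEquiv 2 ℂ K₁ K₂).symm.toContinuousLinearMap ∘L
      ContinuousLinearMap.inl ℂ K₁ K₂
  let J₂ : K₂ →L[ℂ] WithLp 2 (K₁ × K₂) :=
    (WithLp.prodContinuousLinearEquiv 2 ℂ K₁ K₂).symm.toContinuousLinearMap ∘L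
      ContinuousLinearMap.inr ℂ K₁ K₂
  have hJ₁ : ∀ y, V (J₁ y) = J₁ (U₁ y) := fun y => by
    change WithLp.toLp 2 (U₁ y, U₂ 0) = WithLp.toLp 2 (U₁ y, 0)
    rw [map_zero]
  have hJ₂ : ∀ y, V (J₂ y) = J₂ (U₂ y) := fun y => by
    change WithLp.toLp 2 (U₁ 0, U₂ y) = WithLp.toLp 2 (0, U₂ y)
    rw [map_zero]
  have hsplit : ∀ z : WithLp 2 (K₁ × K₂), J₁ z.fst + J₂ z.snd = z := fun z => by
    change WithLp.toLp 2 (z.fst + 0, 0 + z.snd) = z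
    rw [add_zero, zero_add]
    rfl
  have htop : ∀ L : Submodule ℂ (WithLp 2 (K₁ × K₂)), IsClosed (L : Set (WithLp 2 (K₁ × K₂))) →
      IsReducing V L → J₁ φ.fst ∈ L → J₂ φ.snd ∈ L → L = ⊤ := by
    intro L hc hL h₁ h₂
    refine eq_top_iff.2 fun z _ => ?_
    rw [← hsplit z]
    exact L.add_mem (hφ₁.le_comap J₁ hJ₁ hL hc h₁ _) (hφ₂.le_comap J₂ hJ₂ hL hc h₂ _)
  have hsum : unitarySpectralMeasure V φ =
      unitarySpectralMeasure V (J₁ φ.fst) + unitarySpectralMeasure V (J₂ φ.snd) := by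
    have := unitarySpectralMeasure_add_of_orthogonal (inner_inl_zpow_inr U₁ U₂ φ.fst φ.snd)
    rwa [show WithLp.toLp 2 (φ.fst, (0 : K₂)) + WithLp.toLp 2 ((0 : K₁), φ.snd) = φ from
      hsplit φ] at this
  refine hasSimpleSingularSpectrum_of_rankOne (e := J₁ φ.fst) h hne ?_ ?_
  · intro L hc hL h0 h₁
    refine htop L hc hL h₁ ?_
    -- (0, φ₂) is recovered as φ - (φ₁, 0).
    rw [← add_sub_cancel_left (J₁ φ.fst) (J₂ φ.snd), hsplit]
    exact L.sub_mem h0 h₁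
  · have : spectralNullSubspace V {A | unitarySpectralMeasure V φ A = 0} = ⊤ := by
      refine htop _ (isClosed_spectralNullSubspace _ _) (isReducing_spectralNullSubspace _ _) ?_ ?_
      · intro A hA
        rw [Set.mem_ofPred_eq, hsum, Measure.add_apply, add_eq_zero] at hA
        exact hA.1
      · intro A hA
        rw [Set.mem_ofPred_eq, hsum, Measure.add_apply, add_eq_zero] at hA
        exact hA.2
    intro x A hA
    have hx : x ∈ spectralNullSubspace V {A | unitarySpectralMeasure V φ A = 0} := by
      rw [this]
      trivial
    exact hx A hA
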